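/- Let $N\ge 1$ be an integer, $\tau>0$, and $h,v_0,L\in\mathbb{R}$, and put $V(s)=v_0(\tanh(s-h)+\tanh h)$. Let $C^0(\mathbb{R}/N\mathbb{Z})$ and $C^2(\mathbb{R}/N\mathbb{Z})$ be the spaces of real-valued $N$-periodic functions on $\mathbb{R}$ that are continuous, respectively twice continuously differentiable, with the usual $C^0$ and $C^2$ norms. For $u_*\in C^2(\mathbb{R}/N\mathbb{Z})$ define \[ \mathcal{F}^{\mathrm{tw}}: C^2(\mathbb{R}/N\mathbb{Z})\times\mathbb{R}^2\to C^0(\mathbb{R}/N\mathbb{Z})\times\mathbb{R}^2,\qquad (u,c,d)\mapsto \begin{pmatrix} \xi\mapsto c^2\tau u''(\xi)-c\,u'(\xi)-V(u(\xi+1))+V(u(\xi))+d\\[2pt] L-\sum_{n=0}^{N-1}u(n)\\[2pt] \int_0^N u'(\xi)\,(u_*(\xi)-u(\xi))\,\mathrm{d}\xi \end{pmatrix}, \] and denote its first component by $\mathcal{F}^{\mathrm{tw}}_1$. Let $c_*\in\mathbb{R}$ and suppose that (i) $\mathcal{F}^{\mathrm{tw}}(u_*,c_*,0)=0$; (ii)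 the null space of $\mathrm{D}_u\mathcal{F}^{\mathrm{tw}}_1(u_*,c_*,0)$ is two-dimensional and is spanned by $u_*'$ and a function $v\in C^2(\mathbb{R}/N\mathbb{Z})$ with $\sum_{n=0}^{N-1}v(n)\neq0$; (iii) $\mathrm{D}_c\mathcal{F}^{\mathrm{tw}}_1(u_*,c_*,0)$ is not in the range of $\mathrm{D}_u\mathcal{F}^{\mathrm{tw}}_1(u_*,c_*,0)$. Then $\mathcal{F}^{\mathrm{tw}}$ is Fréchet differentiable at $(u_*,c_*,0)$ and its derivative $\mathrm{D}_{(u,c,d)}\mathcal{F}^{\mathrm{tw}}(u_*,c_*,0)$ has a bounded inverse. -/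

import Mathlib

namespace TrafficWave

noncomputable section

instance instFactCastPos (N : ℕ) [NeZero N] : Fact ((0 : ℝ) < (N : ℝ)) :=
  ⟨Nat.cast_pos.mpr (Nat.pos_of_ne_zero (NeZero.ne N))⟩

/-- `C⁰(ℝ/Nℤ)`, the real continuous functions on the circle of length `N`, with the sup norm. -/
abbrev C0 (N : ℕ) : Type := C(AddCircle (N : ℝ), ℝ)

/-- The element of `C⁰(ℝ/Nℤ)` given by a continuous `N`-periodic function on the line. -/
def toC0 {N : ℕ} (f : ℝ → ℝ) (hc : Continuous f) (hp : Function.Periodic f (N : ℝ)) : C0 N where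
  toFun := hp.lift
  continuous_toFun := continuous_coinduced_dom.mpr hc

@[simp] theorem toC0_coe {N : ℕ} (f : ℝ → ℝ) (hc : Continuous f)
    (hp : Function.Periodic f (N : ℝ)) (ξ : ℝ) :
    toC0 f hc hp (ξ : AddCircle (N : ℝ)) = f ξ := rfl

/-- Twice continuously differentiable `N`-periodic functions, as a space of functions. -/
def c2Submodule (N : ℕ) : Submodule ℝ (ℝ → ℝ) where
  carrier := {f | ContDiff ℝ 2 f ∧ Function.Periodic f (N : ℝ)}
  zero_mem' := ⟨contDiff_const, fun _ => rfl⟩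
  add_mem' := fun hf hg => ⟨hf.1.add hg.1, hf.2.add hg.2⟩
  smul_mem' := fun a _ hf => ⟨contDiff_const.smul hf.1, hf.2.smul a⟩

/-- The space `C²(ℝ/Nℤ)`. It is a type of its own, so that it carries the `C²` norm below and not
the topology of pointwise convergence. -/
def C2 (N : ℕ) : Type := ↥(c2Submodule N)

namespace C2

variable {N : ℕ}

instance : AddCommGroup (C2 N) := inferInstanceAs (AddCommGroup ↥(c2Submodule N))

instance : Module ℝ (C2 N) := inferInstanceAs (Module ℝ ↥(c2Submodule N))

instance : CoeFun (C2 N) (fun _ => ℝ → ℝ) := ⟨fun u => u.1⟩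

@[ext] theorem ext {u w : C2 N} (h : ∀ ξ : ℝ, u ξ = w ξ) : u = w := Subtype.ext (funext h)

@[simp] theorem coe_add (u w : C2 N) : (⇑(u + w) : ℝ → ℝ) = u + w := rfl

@[simp] theorem coe_smul (a : ℝ) (u : C2 N) : (⇑(a • u) : ℝ → ℝ) = a • (u : ℝ → ℝ) := rfl

theorem contDiff (u : C2 N) : ContDiff ℝ 2 u := u.2.1

theorem periodic (u : C2 N) : Function.Periodic u (N : ℝ) := u.2.2

theorem continuous (u : C2 N) : Continuous u := u.contDiff.continuous

theorem contDiff_deriv (u : C2 N) : ContDiff ℝ 1 (deriv u) :=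
  (contDiff_succ_iff_deriv.mp (show ContDiff ℝ (1 + 1) u from u.contDiff)).2.2

theorem continuous_deriv (u : C2 N) : Continuous (deriv u) := u.contDiff_deriv.continuous

theorem continuous_deriv2 (u : C2 N) : Continuous (deriv (deriv u)) :=
  u.contDiff_deriv.continuous_deriv le_rfl

theorem differentiable (u : C2 N) : Differentiable ℝ u := u.contDiff.differentiable (by norm_num)

theorem differentiable_deriv (u : C2 N) : Differentiable ℝ (deriv u) :=
  u.contDiff_deriv.differentiable (by norm_num)

end C2

theorem periodic_deriv {f : ℝ → ℝ} {p : ℝ} (hf : Function.Periodic f p) :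
    Function.Periodic (deriv f) p := fun x => by
  rw [← deriv_comp_add_const, show (fun y => f (y + p)) = f from funext hf]

/-- The 2-jet `u ↦ (u, u', u'')`, a linear map `C²(ℝ/Nℤ) → C⁰(ℝ/Nℤ)³`. -/
def C2.jet (N : ℕ) : C2 N →ₗ[ℝ] C0 N × C0 N × C0 N where
  toFun u := (toC0 u u.continuous u.periodic,
    toC0 (deriv u) u.continuous_deriv (periodic_deriv u.periodic),
    toC0 (deriv (deriv u)) u.continuous_deriv2 (periodic_deriv (periodic_deriv u.periodic)))
  map_add' u w := by
    have h1 : deriv (⇑(u + w)) = deriv u + deriv w :=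
      funext fun x => deriv_add (u.differentiable x) (w.differentiable x)
    have h2 : deriv (deriv (⇑(u + w))) = deriv (deriv u) + deriv (deriv w) := by
      rw [h1]
      exact funext fun x => deriv_add (u.differentiable_deriv x) (w.differentiable_deriv x)
    refine Prod.ext ?_ (Prod.ext ?_ ?_) <;> refine ContinuousMap.ext fun x => ?_ <;>
      induction x using QuotientAddGroup.induction_on with | H x => ?_
    · rfl
    · exact congrFun h1 x
    · exact congrFun h2 x
  map_smul' a u := by
    have h1 : deriv (⇑(a • u)) = a • deriv u :=
      funext fun x => deriv_const_smul a (u.differentiable x)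
    have h2 : deriv (deriv (⇑(a • u))) = a • deriv (deriv u) := by
      rw [h1]
      exact funext fun x => deriv_const_smul a (u.differentiable_deriv x)
    refine Prod.ext ?_ (Prod.ext ?_ ?_) <;> refine ContinuousMap.ext fun x => ?_ <;>
      induction x using QuotientAddGroup.induction_on with | H x => ?_
    · rfl
    · exact congrFun h1 x
    · exact congrFun h2 x

theorem C2.jet_injective (N : ℕ) : Function.Injective (C2.jet N) := fun _ _ h =>
  C2.ext fun ξ => DFunLike.congr_fun (congrArg Prod.fst h) (ξ : AddCircle (N : ℝ))

section Norm

variable (N : ℕ) [NeZero N]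

/-- The `C²` norm `‖u‖ = max (sup |u|, sup |u'|, sup |u''|)`. -/
instance : NormedAddCommGroup (C2 N) :=
  NormedAddCommGroup.induced (C2 N) (C0 N × C0 N × C0 N) (C2.jet N) (C2.jet_injective N)

instance : NormedSpace ℝ (C2 N) :=
  NormedSpace.induced ℝ (C2 N) (C0 N × C0 N × C0 N) (C2.jet N)

end Norm

/-- The optimal velocity function `V(s) = v₀ (tanh (s - h) + tanh h)`. -/
def optVel (h v₀ s : ℝ) : ℝ := v₀ * (Real.tanh (s - h) + Real.tanh h)

theorem continuous_optVel (h v₀ : ℝ) : Continuous (optVel h v₀) := by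
  have : Continuous Real.tanh := by
    rw [show Real.tanh = fun x => Real.sinh x / Real.cosh x from
      funext Real.tanh_eq_sinh_div_cosh]
    exact Real.continuous_sinh.div Real.continuous_cosh fun x => (Real.cosh_pos x).ne'
  unfold optVel
  fun_prop

variable {N : ℕ}

/-- First component of the traveling-wave map, the delay-differential expression
`c² τ u''(ξ) - c u'(ξ) - V(u(ξ+1)) + V(u(ξ)) + d`. -/
def waveMap₁ (τ h v₀ : ℝ) (u : C2 N) (c d : ℝ) : C0 N :=
  toC0
    (fun ξ => c ^ 2 * τ * deriv (deriv u) ξ - c * deriv u ξ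
      - optVel h v₀ (u (ξ + 1)) + optVel h v₀ (u ξ) + d)
    (by
      have := continuous_optVel h v₀
      have := u.continuous
      have := u.continuous_deriv
      have := u.continuous_deriv2
      fun_prop)
    (fun ξ => by
      have h3 : u (ξ + N + 1) = u (ξ + 1) := by
        rw [add_right_comm]; exact u.periodic (ξ + 1)
      simp only [h3, u.periodic ξ, periodic_deriv u.periodic ξ,
        periodic_deriv (periodic_deriv u.periodic) ξ])

/-- The traveling-wave map `C²(ℝ/Nℤ) × ℝ² → C⁰(ℝ/Nℤ) × ℝ²`: delay-differential equation, total
length `L` of the road, and phase condition with reference profile `uRef`. -/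
def waveMap (τ h v₀ L : ℝ) (uRef : C2 N) (p : C2 N × ℝ × ℝ) : C0 N × ℝ × ℝ :=
  (waveMap₁ τ h v₀ p.1 p.2.1 p.2.2,
    L - ∑ n ∈ Finset.range N, p.1 (n : ℝ),
    ∫ ξ in (0 : ℝ)..(N : ℝ), deriv p.1 ξ * (uRef ξ - p.1 ξ))

/-- The partial derivative `D_u` at `(u, c, d)` of the first component. -/
def Du [NeZero N] (τ h v₀ : ℝ) (u : C2 N) (c d : ℝ) : C2 N →L[ℝ] C0 N :=
  fderiv ℝ (fun w : C2 N => waveMap₁ τ h v₀ w c d) u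

/-- The partial derivative `D_c` at `(u, c, d)` of the first component. -/
def Dc [NeZero N] (τ h v₀ : ℝ) (u : C2 N) (c d : ℝ) : C0 N :=
  deriv (fun s : ℝ => waveMap₁ τ h v₀ u s d) c

end

end TrafficWave

/-!
The derivative `T` of the traveling-wave map at `(u, c, 0)` is computed in closed form
(`hasFDerivAt_waveMap`), and its invertibility follows from the Fredholm alternative once `T` is
known to be injective and, up to an isomorphism, a compact perturbation of a nonzero multiple of the
identity.

*Wave speed.* If `c = 0`, the linearization in `u` is `w ↦ V'(u) w - (V'(u) w)(· + 1)`, whose kernel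
contains `g cosh² (u - h)` for every smooth 1-periodic `g`; taking `g = 1, cos 2πx, sin 2πx` shows
that its dimension is not two (`speed_ne_zero`). So `c² τ ≠ 0`, and the equation is of second order.

*Compactness.* The map `w ↦ w'' + mean w` is an isomorphism `C² ≃ C⁰` whose inverse is written with
the mean-zero primitive operator (`solveEquiv`). The primitive operator is compact on `C⁰` by
Arzelà–Ascoli (`isCompactOperator_primitive`), so that composing `T` with this isomorphism gives
`c² τ` plus a compact operator (`isCompactOperator_waveDeriv_solve`).

*Injectivity* (`injective_waveDeriv`). Let `T (w, s, d) = 0`. Integrated over a period, the first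
component reads `N d = 0`, since derivatives integrate to zero and the two terms with `V'` differ by
a translation. Then `s = 0` because the `c`-derivative is not in the range of the `u`-derivative.
Thus `w = a u' + b v`. As `∑ u'(n) = 0` (`sumNat_deriv_eq_zero`) and `∑ v(n) ≠ 0`, the second
component gives `b = 0`, and the third, `a ∫ u'² = 0`, gives `a = 0`; here `u' ≠ 0` because the
kernel is two-dimensional.
-/

namespace TrafficWave

noncomputable section

/-! ### Periodic functions as functions on the line -/

variable {N : ℕ}

/-- Two elements of `C⁰(ℝ/Nℤ)` agree if they agree as functions on the line. -/
theorem C0.ext_coe {f g : C0 N} (hfg : ∀ ξ : ℝ, f ξ = g ξ) : f = g :=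
  ContinuousMap.ext fun x => QuotientAddGroup.induction_on x hfg

theorem C0.continuous_coe (f : C0 N) : Continuous fun ξ : ℝ => f ξ :=
  f.continuous.comp (AddCircle.continuous_mk' _)

theorem C0.intervalIntegrable (f : C0 N) (a b : ℝ) :
    IntervalIntegrable (fun ξ : ℝ => f ξ) MeasureTheory.volume a b :=
  f.continuous_coe.intervalIntegrable a b

theorem C0.periodic_coe (f : C0 N) : Function.Periodic (fun ξ : ℝ => f ξ) (N : ℝ) := fun ξ => by
  simp only [AddCircle.coe_add_period]

/-- On the circle, a Lipschitz bound on the line is a Lipschitz bound for the quotient distance. -/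
theorem lipschitzWith_of_coe {f : C0 N} {K : NNReal}
    (hf : ∀ a b : ℝ, |f a - f b| ≤ K * |a - b|) : LipschitzWith K f := by
  refine LipschitzWith.of_dist_le_mul fun x y => ?_
  induction x using QuotientAddGroup.induction_on with | H a => ?_
  induction y using QuotientAddGroup.induction_on with | H b => ?_
  -- The representative of `b` nearest to `a` realizes the quotient distance.
  have hb : f b = f ((b + round ((N : ℝ)⁻¹ * (a - b)) * N : ℝ) : AddCircle (N : ℝ)) := by
    rw [AddCircle.coe_add, ← zsmul_eq_mul, AddCircle.coe_zsmul, AddCircle.coe_period, smul_zero,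
      add_zero]
  rw [dist_eq_norm, dist_eq_norm]
  change ‖f (a : AddCircle (N : ℝ)) - f (b : AddCircle (N : ℝ))‖
    ≤ K * ‖((a : AddCircle (N : ℝ)) - (b : AddCircle (N : ℝ)))‖
  rw [← AddCircle.coe_sub, AddCircle.norm_eq, hb, Real.norm_eq_abs]
  exact (hf _ _).trans_eq (by rw [sub_sub])

variable (N) in
/-- The functional `w ↦ ∑ w(n)` over the integer points of a period. -/
def sumNat : C0 N →L[ℝ] ℝ :=
  ∑ n ∈ Finset.range N, ContinuousMap.evalCLM ℝ (((n : ℝ) : AddCircle (N : ℝ)))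

theorem sumNat_apply (f : C0 N) :
    sumNat N f = ∑ n ∈ Finset.range N, f ((n : ℝ) : AddCircle (N : ℝ)) := by
  simp [sumNat]

/-- The coercion of `C²` functions to functions on the line, as a linear map. -/
def C2.coeLinear (N : ℕ) : C2 N →ₗ[ℝ] (ℝ → ℝ) := (c2Submodule N).subtype

theorem C2.coeLinear_injective (N : ℕ) : Function.Injective (C2.coeLinear N) :=
  Subtype.val_injective

/-- A two-dimensional space of `C²` functions spanned by `f` and `g` forces `f ≠ 0`. -/
theorem ne_zero_of_finrank_eq_two {K : Submodule ℝ (C2 N)} {f g : ℝ → ℝ}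
    (hdim : Module.finrank ℝ K = 2)
    (hspan : K.map (C2.coeLinear N) = Submodule.span ℝ {f, g}) : f ≠ 0 := by
  rintro rfl
  have h1 := (Submodule.equivMapOfInjective _ (C2.coeLinear_injective N) K).finrank_eq
  rw [hdim, hspan, Submodule.span_insert_zero] at h1
  have h2 := finrank_span_le_card (R := ℝ) ({g} : Set (ℝ → ℝ))
  rw [Set.toFinset_singleton, Finset.card_singleton] at h2
  omega

/-! ### The optimal velocity function and its superposition operator -/

/-- The derivative `V'(s) = v₀ / cosh² (s - h)` of the optimal velocity function. -/
def optVelDeriv (h v₀ s : ℝ) : ℝ := v₀ / Real.cosh (s - h) ^ 2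

theorem hasDerivAt_optVel (h v₀ s : ℝ) :
    HasDerivAt (optVel h v₀) (optVelDeriv h v₀ s) s := by
  have hc := (Real.cosh_pos (s - h)).ne'
  have hs : HasDerivAt (fun x : ℝ => x - h) 1 s := (hasDerivAt_id s).sub_const h
  have h1 := (((hs.sinh.div hs.cosh hc).add_const (Real.tanh h)).const_mul v₀)
  have h2 : optVel h v₀ = fun x => v₀ * (Real.sinh (x - h) / Real.cosh (x - h) + Real.tanh h) := by
    funext x
    rw [optVel, Real.tanh_eq_sinh_div_cosh (x - h)]
  rw [h2]
  refine h1.congr_deriv ?_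
  rw [optVelDeriv, show Real.cosh (s - h) * 1 * Real.cosh (s - h)
    - Real.sinh (s - h) * (Real.sinh (s - h) * 1) = 1 by
      linear_combination Real.cosh_sq (s - h)]
  ring

theorem hasDerivAt_optVelDeriv (h v₀ s : ℝ) :
    HasDerivAt (optVelDeriv h v₀)
      (-(2 * v₀) * Real.sinh (s - h) / Real.cosh (s - h) ^ 3) s := by
  have hc := (Real.cosh_pos (s - h)).ne'
  have hs : HasDerivAt (fun x : ℝ => x - h) 1 s := (hasDerivAt_id s).sub_const h
  refine ((hasDerivAt_const s v₀).div (hs.cosh.pow 2) (pow_ne_zero 2 hc)).congr_deriv ?_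
  simp only [Pi.pow_apply]
  field_simp
  ring

theorem continuous_optVelDeriv (h v₀ : ℝ) : Continuous (optVelDeriv h v₀) :=
  continuous_iff_continuousAt.mpr fun s => (hasDerivAt_optVelDeriv h v₀ s).continuousAt

theorem abs_optVelDeriv_sub_le (h v₀ a b : ℝ) :
    |optVelDeriv h v₀ b - optVelDeriv h v₀ a| ≤ 2 * |v₀| * |b - a| := by
  refine Convex.norm_image_sub_le_of_norm_hasDerivWithin_le (s := Set.univ)
    (fun x _ => (hasDerivAt_optVelDeriv h v₀ x).hasDerivWithinAt) (fun x _ => ?_)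
    convex_univ (Set.mem_univ a) (Set.mem_univ b)
  have hc := Real.one_le_cosh (x - h)
  have hc0 := Real.cosh_pos (x - h)
  have hs : |Real.sinh (x - h)| ≤ Real.cosh (x - h) ^ 3 := by
    have h1 : |Real.sinh (x - h)| ≤ Real.cosh (x - h) :=
      abs_le_of_sq_le_sq (by linarith [Real.cosh_sq (x - h)]) hc0.le
    exact h1.trans (le_self_pow₀ hc (by norm_num))
  rw [Real.norm_eq_abs, abs_div, abs_mul, abs_neg, abs_mul, abs_two, abs_of_pos (pow_pos hc0 3),
    div_le_iff₀ (pow_pos hc0 3)]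
  gcongr

theorem abs_optVel_taylor_le (h v₀ a b : ℝ) :
    |optVel h v₀ b - optVel h v₀ a - optVelDeriv h v₀ a * (b - a)| ≤ 2 * |v₀| * |b - a| ^ 2 := by
  have key := Convex.norm_image_sub_le_of_norm_hasDerivWithin_le (s := Set.uIcc a b)
    (f := fun x => optVel h v₀ x - optVelDeriv h v₀ a * x)
    (f' := fun x => optVelDeriv h v₀ x - optVelDeriv h v₀ a) (C := 2 * |v₀| * |b - a|)
    (fun x _ => ((hasDerivAt_optVel h v₀ x).sub
      (by simpa using (hasDerivAt_id x).const_mul (optVelDeriv h v₀ a))).hasDerivWithinAt)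
    (fun x hx => (abs_optVelDeriv_sub_le h v₀ a x).trans (by
      gcongr 2 * |v₀| * ?_
      exact Set.abs_sub_left_of_mem_uIcc hx))
    (convex_uIcc a b) Set.left_mem_uIcc Set.right_mem_uIcc
  simp only [Real.norm_eq_abs] at key
  calc _ = |optVel h v₀ b - optVelDeriv h v₀ a * b
        - (optVel h v₀ a - optVelDeriv h v₀ a * a)| := by congr 1; ring
    _ ≤ _ := key.trans_eq (by ring)

/-- Superposition with the optimal velocity function, `f ↦ V ∘ f`, on `C⁰(ℝ/Nℤ)`. -/
def velComp (h v₀ : ℝ) (f : C0 N) : C0 N := ⟨fun x => optVel h v₀ (f x), by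
  have := continuous_optVel h v₀; fun_prop⟩

/-- The function `V' ∘ f` of `C⁰(ℝ/Nℤ)`. -/
def velDerivComp (h v₀ : ℝ) (f : C0 N) : C0 N := ⟨fun x => optVelDeriv h v₀ (f x), by
  have := continuous_optVelDeriv h v₀; fun_prop⟩

/-- The function `g · cosh² (u - h)` for a smooth 1-periodic `g`; multiplied by `V'(u)` it becomes
`v₀ g`. -/
def weighted (h : ℝ) (u : C2 N) (g : ℝ → ℝ) (hg : ContDiff ℝ 2 g)
    (hp : Function.Periodic g 1) : C2 N :=
  ⟨fun x => g x * Real.cosh (u x - h) ^ 2,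
    hg.mul ((Real.contDiff_cosh.comp (u.contDiff.sub contDiff_const)).pow 2), fun x => by
      have := hp.nat_mul N x
      rw [mul_one] at this
      simp only [this, u.periodic x]⟩

theorem weighted_coe (h : ℝ) (u : C2 N) (g : ℝ → ℝ) (hg : ContDiff ℝ 2 g)
    (hp : Function.Periodic g 1) (x : ℝ) :
    weighted h u g hg hp x = g x * Real.cosh (u x - h) ^ 2 := rfl

variable [NeZero N]

/-- Superposition with `V` is Fréchet differentiable on `C⁰`; the remainder is quadratic because
`V'` is Lipschitz. -/
theorem hasFDerivAt_velComp (h v₀ : ℝ) (f : C0 N) :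
    HasFDerivAt (velComp h v₀) (ContinuousLinearMap.mul ℝ (C0 N) (velDerivComp h v₀ f)) f := by
  refine HasFDerivAt.of_isLittleO ?_
  have hO : (fun g : C0 N => velComp h v₀ g - velComp h v₀ f
      - ContinuousLinearMap.mul ℝ (C0 N) (velDerivComp h v₀ f) (g - f)) =O[nhds f]
      fun g => ‖g - f‖ ^ 2 := by
    refine Asymptotics.IsBigO.of_bound (2 * |v₀|) (Filter.Eventually.of_forall fun g => ?_)
    refine (ContinuousMap.norm_le _ (by positivity)).mpr fun x => ?_
    refine (abs_optVel_taylor_le h v₀ (f x) (g x)).trans ?_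
    rw [Real.norm_of_nonneg (by positivity)]
    gcongr
    exact (g - f).norm_coe_le_norm x
  refine hO.trans_isLittleO ?_
  have h0 : Filter.Tendsto (fun g : C0 N => g - f) (nhds f) (nhds 0) := by
    have : Continuous fun g : C0 N => g - f := by fun_prop
    simpa using this.tendsto f
  exact ((Asymptotics.isLittleO_norm_pow_id one_lt_two).comp_tendsto h0)

/-! ### Jets, translation and integration as bounded operators -/

variable (N) in
/-- The 2-jet as a bounded operator; it is isometric by definition of the `C²` norm. -/
def C2.jetL : C2 N →L[ℝ] C0 N × C0 N × C0 N :=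
  (C2.jet N).mkContinuous 1 fun u => (one_mul ‖u‖).ge

variable (N) in
/-- The inclusion `C² → C⁰`. -/
def C2.d0 : C2 N →L[ℝ] C0 N := (ContinuousLinearMap.fst ℝ _ _).comp (C2.jetL N)

variable (N) in
/-- The derivative `u ↦ u'` as a bounded operator `C² → C⁰`. -/
def C2.d1 : C2 N →L[ℝ] C0 N :=
  ((ContinuousLinearMap.fst ℝ _ _).comp (ContinuousLinearMap.snd ℝ _ _)).comp (C2.jetL N)

variable (N) in
/-- The second derivative `u ↦ u''` as a bounded operator `C² → C⁰`. -/
def C2.d2 : C2 N →L[ℝ] C0 N :=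
  ((ContinuousLinearMap.snd ℝ _ _).comp (ContinuousLinearMap.snd ℝ _ _)).comp (C2.jetL N)

@[simp] theorem C2.d0_coe (u : C2 N) (ξ : ℝ) : C2.d0 N u ξ = u ξ := rfl

@[simp] theorem C2.d1_coe (u : C2 N) (ξ : ℝ) : C2.d1 N u ξ = deriv u ξ := rfl

@[simp] theorem C2.d2_coe (u : C2 N) (ξ : ℝ) : C2.d2 N u ξ = deriv (deriv u) ξ := rfl

theorem C2.norm_le_of_jet {u : C2 N} {C : ℝ} (h0 : ‖C2.d0 N u‖ ≤ C) (h1 : ‖C2.d1 N u‖ ≤ C)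
    (h2 : ‖C2.d2 N u‖ ≤ C) : ‖u‖ ≤ C :=
  max_le h0 (max_le h1 h2)

variable (N) in
/-- Translation `f ↦ f(· + 1)` on `C⁰(ℝ/Nℤ)`. -/
def shift : C0 N →L[ℝ] C0 N :=
  LinearMap.mkContinuous
    { toFun := fun f => f.comp ⟨fun x => x + ((1 : ℝ) : AddCircle (N : ℝ)), by fun_prop⟩
      map_add' := fun _ _ => rfl
      map_smul' := fun _ _ => rfl } 1 fun f => by
    rw [one_mul]
    exact (ContinuousMap.norm_le _ (norm_nonneg f)).mpr fun x => f.norm_coe_le_norm _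

@[simp] theorem shift_coe (f : C0 N) (ξ : ℝ) : shift N f ξ = f ((ξ + 1 : ℝ) : AddCircle (N : ℝ)) :=
  rfl

theorem shift_mul (f g : C0 N) : shift N (f * g) = shift N f * shift N g := rfl

theorem velDerivComp_shift (h v₀ : ℝ) (f : C0 N) :
    velDerivComp h v₀ (shift N f) = shift N (velDerivComp h v₀ f) := rfl

theorem C0.norm_integral_le (f : C0 N) (a b : ℝ) :
    ‖∫ ξ in a..b, f ξ‖ ≤ ‖f‖ * |b - a| :=
  intervalIntegral.norm_integral_le_of_norm_le_const fun _ _ => f.norm_coe_le_norm _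

variable (N) in
/-- Integration over a period, `f ↦ ∫₀ᴺ f`, as a bounded functional. -/
def integral : C0 N →L[ℝ] ℝ :=
  LinearMap.mkContinuous
    { toFun := fun f => ∫ ξ in (0 : ℝ)..(N : ℝ), f ξ
      map_add' := fun f g =>
        intervalIntegral.integral_add (f.intervalIntegrable _ _) (g.intervalIntegrable _ _)
      map_smul' := fun a f => intervalIntegral.integral_smul a fun ξ : ℝ => f ξ }
    (N : ℝ) fun f => by
    refine (f.norm_integral_le 0 N).trans_eq ?_
    rw [sub_zero, Nat.abs_cast, mul_comm]

theorem integral_apply (f : C0 N) : integral N f = ∫ ξ in (0 : ℝ)..(N : ℝ), f ξ := rfl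

theorem integral_shift (f : C0 N) : integral N (shift N f) = integral N f := by
  have h1 := intervalIntegral.integral_comp_add_right (a := 0) (b := (N : ℝ))
    (fun ξ : ℝ => f ξ) 1
  have h2 := f.periodic_coe.intervalIntegral_add_eq 0 1
  simp only [integral_apply, shift_coe]
  rw [h1, zero_add, add_comm (N : ℝ) 1, ← h2, zero_add]

theorem integral_one : integral N 1 = N := by simp [integral_apply]

theorem integral_deriv_eq_zero (u : C2 N) : integral N (C2.d1 N u) = 0 := by
  simp only [integral_apply, C2.d1_coe]
  rw [intervalIntegral.integral_deriv_eq_sub (fun x _ => u.differentiable x)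
    (u.continuous_deriv.intervalIntegrable _ _), ← zero_add (N : ℝ), u.periodic 0, sub_self]

theorem integral_deriv2_eq_zero (u : C2 N) : integral N (C2.d2 N u) = 0 := by
  simp only [integral_apply, C2.d2_coe]
  rw [intervalIntegral.integral_deriv_eq_sub (fun x _ => u.differentiable_deriv x)
    (u.continuous_deriv2.intervalIntegrable _ _), ← zero_add (N : ℝ),
    periodic_deriv u.periodic 0, sub_self]

/-! ### Derivatives of the traveling-wave map -/

theorem waveMap₁_eq (τ h v₀ : ℝ) (u : C2 N) (c d : ℝ) :
    waveMap₁ τ h v₀ u c d = (c ^ 2 * τ) • C2.d2 N u - c • C2.d1 N u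
      - velComp h v₀ (shift N (C2.d0 N u)) + velComp h v₀ (C2.d0 N u) + d • (1 : C0 N) :=
  C0.ext_coe fun ξ => by
    change _ = c ^ 2 * τ * deriv (deriv u) ξ - c * deriv u ξ - optVel h v₀ (u (ξ + 1))
      + optVel h v₀ (u ξ) + d * 1
    rw [mul_one]
    rfl

/-- The lower-order part `w ↦ -V'(u(· + 1)) w(· + 1) + V'(u) w` of the linearization. -/
def linVel (h v₀ : ℝ) (u : C2 N) : C0 N →L[ℝ] C0 N :=
  -(ContinuousLinearMap.mul ℝ (C0 N) (velDerivComp h v₀ (shift N (C2.d0 N u)))).comp (shift N)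
    + ContinuousLinearMap.mul ℝ (C0 N) (velDerivComp h v₀ (C2.d0 N u))

theorem linVel_apply (h v₀ : ℝ) (u : C2 N) (f : C0 N) :
    linVel h v₀ u f = -(velDerivComp h v₀ (shift N (C2.d0 N u)) * shift N f)
      + velDerivComp h v₀ (C2.d0 N u) * f := rfl

theorem integral_linVel (h v₀ : ℝ) (u : C2 N) (f : C0 N) :
    integral N (linVel h v₀ u f) = 0 := by
  rw [linVel_apply, velDerivComp_shift, ← shift_mul, map_add, map_neg, integral_shift,
    neg_add_cancel]

/-- The linearization in `u` of the first component of the traveling-wave map. -/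
def linWave (τ h v₀ : ℝ) (u : C2 N) (c : ℝ) : C2 N →L[ℝ] C0 N :=
  (c ^ 2 * τ) • C2.d2 N - c • C2.d1 N + (linVel h v₀ u).comp (C2.d0 N)

theorem linWave_apply (τ h v₀ : ℝ) (u : C2 N) (c : ℝ) (w : C2 N) :
    linWave τ h v₀ u c w =
      (c ^ 2 * τ) • C2.d2 N w - c • C2.d1 N w + linVel h v₀ u (C2.d0 N w) := rfl

theorem integral_linWave (τ h v₀ : ℝ) (u : C2 N) (c : ℝ) (w : C2 N) :
    integral N (linWave τ h v₀ u c w) = 0 := by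
  simp [linWave_apply, integral_linVel, integral_deriv_eq_zero, integral_deriv2_eq_zero]

/-- The derivative in `c` of the first component of the traveling-wave map. -/
def waveDc (τ : ℝ) (u : C2 N) (c : ℝ) : C0 N := (2 * c * τ) • C2.d2 N u - C2.d1 N u

theorem integral_waveDc (τ : ℝ) (u : C2 N) (c : ℝ) : integral N (waveDc τ u c) = 0 := by
  simp [waveDc, integral_deriv_eq_zero, integral_deriv2_eq_zero]

open ContinuousLinearMap in
/-- The derivative of the first component of the traveling-wave map in all its variables. -/
def waveDeriv₁ (τ h v₀ : ℝ) (u : C2 N) (c : ℝ) : C2 N × ℝ × ℝ →L[ℝ] C0 N :=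
  (linWave τ h v₀ u c).comp (fst ℝ _ _)
    + ((fst ℝ ℝ ℝ).comp (snd ℝ (C2 N) _)).smulRight (waveDc τ u c)
    + ((snd ℝ ℝ ℝ).comp (snd ℝ (C2 N) _)).smulRight (1 : C0 N)

theorem waveDeriv₁_apply (τ h v₀ : ℝ) (u : C2 N) (c : ℝ) (q : C2 N × ℝ × ℝ) :
    waveDeriv₁ τ h v₀ u c q =
      linWave τ h v₀ u c q.1 + q.2.1 • waveDc τ u c + q.2.2 • (1 : C0 N) := rfl

theorem hasFDerivAt_waveMap₁ (τ h v₀ : ℝ) (p : C2 N × ℝ × ℝ) :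
    HasFDerivAt (fun q : C2 N × ℝ × ℝ => waveMap₁ τ h v₀ q.1 q.2.1 q.2.2)
      (waveDeriv₁ τ h v₀ p.1 p.2.1) p := by
  simp only [waveMap₁_eq]
  have hu : HasFDerivAt (fun q : C2 N × ℝ × ℝ => q.1) (ContinuousLinearMap.fst ℝ _ _) p :=
    hasFDerivAt_fst
  have hcd : HasFDerivAt (fun q : C2 N × ℝ × ℝ => q.2) (ContinuousLinearMap.snd ℝ _ _) p :=
    hasFDerivAt_snd
  have hc := hcd.fst
  have hd := hcd.snd
  have h0 := (C2.d0 N).hasFDerivAt.comp p hu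
  have h1 := (C2.d1 N).hasFDerivAt.comp p hu
  have h2 := (C2.d2 N).hasFDerivAt.comp p hu
  have hs := (shift N).hasFDerivAt.comp p h0
  have hV0 := (hasFDerivAt_velComp h v₀ _).comp p h0
  have hV1 := (hasFDerivAt_velComp h v₀ _).comp p hs
  refine ((((((hc.pow 2).mul_const τ).smul h2).sub (hc.smul h1)).sub hV1).add hV0).add
    (hd.smul_const (1 : C0 N)) |>.congr_fderiv ?_
  refine ContinuousLinearMap.ext fun q => C0.ext_coe fun ξ => ?_
  simp [waveDeriv₁_apply, linWave_apply, linVel_apply, waveDc]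
  ring

theorem Du_eq (τ h v₀ : ℝ) (u : C2 N) (c d : ℝ) :
    Du τ h v₀ u c d = linWave τ h v₀ u c := by
  have h1 : HasFDerivAt (fun w : C2 N => (w, c, d)) (ContinuousLinearMap.inl ℝ (C2 N) (ℝ × ℝ)) u :=
    hasFDerivAt_prodMk_left u (c, d)
  refine ((hasFDerivAt_waveMap₁ τ h v₀ (u, c, d)).comp u h1).fderiv.trans ?_
  ext w : 1
  simp [waveDeriv₁_apply]

theorem Dc_eq (τ h v₀ : ℝ) (u : C2 N) (c d : ℝ) : Dc τ h v₀ u c d = waveDc τ u c := by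
  have h1 : HasDerivAt (fun s : ℝ => ((u, s, d) : C2 N × ℝ × ℝ)) (0, 1, 0) c :=
    (hasDerivAt_const c u).prodMk ((hasDerivAt_id c).prodMk (hasDerivAt_const c d))
  refine ((hasFDerivAt_waveMap₁ τ h v₀ (u, c, d)).comp_hasDerivAt c h1).deriv.trans ?_
  simp [waveDeriv₁_apply]

open ContinuousLinearMap in
/-- The derivative of the traveling-wave map with reference profile `u`, at `(u, c, d)`. The
reference profile being `u` itself, only the variation of `u_* - u` contributes to the derivative of
the phase condition. -/
def waveDeriv (τ h v₀ : ℝ) (u : C2 N) (c : ℝ) : C2 N × ℝ × ℝ →L[ℝ] C0 N × ℝ × ℝ :=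
  (waveDeriv₁ τ h v₀ u c).prod
    ((-(sumNat N).comp ((C2.d0 N).comp (fst ℝ (C2 N) (ℝ × ℝ)))).prod
      (-(integral N).comp ((ContinuousLinearMap.mul ℝ (C0 N) (C2.d1 N u)).comp
        ((C2.d0 N).comp (fst ℝ (C2 N) (ℝ × ℝ))))))

theorem waveDeriv_apply (τ h v₀ : ℝ) (u : C2 N) (c : ℝ) (q : C2 N × ℝ × ℝ) :
    waveDeriv τ h v₀ u c q = (waveDeriv₁ τ h v₀ u c q, -sumNat N (C2.d0 N q.1),
      -integral N (C2.d1 N u * C2.d0 N q.1)) := rfl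

theorem hasFDerivAt_waveMap (τ h v₀ L : ℝ) (u : C2 N) (c d : ℝ) :
    HasFDerivAt (waveMap τ h v₀ L u) (waveDeriv τ h v₀ u c) (u, c, d) := by
  have hu : HasFDerivAt (fun q : C2 N × ℝ × ℝ => q.1) (ContinuousLinearMap.fst ℝ _ _) (u, c, d) :=
    hasFDerivAt_fst
  have h0 := (C2.d0 N).hasFDerivAt.comp (u, c, d) hu
  have h1 := (C2.d1 N).hasFDerivAt.comp (u, c, d) hu
  have hsum := ((sumNat N).hasFDerivAt.comp (u, c, d) h0).const_sub L
  have hint := (integral N).hasFDerivAt.comp (u, c, d) (h1.mul (h0.const_sub (C2.d0 N u)))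
  refine ((hasFDerivAt_waveMap₁ τ h v₀ (u, c, d)).prodMk
    (hsum.prodMk hint)).congr_fderiv ?_ |>.congr_of_eventuallyEq
      (Filter.Eventually.of_forall fun q => ?_)
  · refine ContinuousLinearMap.ext fun q => ?_
    simp [waveDeriv_apply]
  · refine Prod.ext rfl (Prod.ext ?_ ?_)
    · simp [waveMap, sumNat_apply]
    · simp [waveMap, integral_apply]

/-! ### The mean-zero primitive and the second-order model operator -/

variable (N) in
/-- The mean value `N⁻¹ ∫₀ᴺ f`. -/
def mean : C0 N →L[ℝ] ℝ := (N : ℝ)⁻¹ • integral N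

theorem natCast_mul_mean (f : C0 N) : (N : ℝ) * mean N f = integral N f :=
  mul_inv_cancel_left₀ (NeZero.ne (N : ℝ)) _

theorem mean_const (a : ℝ) : mean N (a • (1 : C0 N)) = a := by
  have := NeZero.ne (N : ℝ)
  simp [mean, integral_one, this]

/-- The primitive of `f - mean f` that vanishes at `0`; it is periodic because `f - mean f` has
mean zero. -/
def primitive₀ (f : C0 N) : C0 N :=
  toC0 (fun x => ∫ ξ in (0 : ℝ)..x, (f - mean N f • (1 : C0 N)) ξ)
    (intervalIntegral.continuous_primitive (fun a b => C0.intervalIntegrable _ a b) 0)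
    (fun x => by
      have h1 := (f - mean N f • (1 : C0 N)).periodic_coe.intervalIntegral_add_eq 0 x
      have h2 : integral N (f - mean N f • (1 : C0 N)) = 0 := by
        rw [map_sub, map_smul, integral_one, smul_eq_mul, mul_comm, natCast_mul_mean, sub_self]
      rw [integral_apply] at h2
      rw [zero_add, h2] at h1
      dsimp only
      rw [← intervalIntegral.integral_add_adjacent_intervals
        (C0.intervalIntegrable _ 0 x) (C0.intervalIntegrable _ x (x + N)), ← h1, add_zero])

theorem primitive₀_coe (f : C0 N) (x : ℝ) :
    primitive₀ f x = ∫ ξ in (0 : ℝ)..x, (f - mean N f • (1 : C0 N)) ξ := rfl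

theorem hasDerivAt_primitive₀ (f : C0 N) (x : ℝ) :
    HasDerivAt (fun y : ℝ => primitive₀ f y) (f x - mean N f) x := by
  simp only [primitive₀_coe]
  refine (intervalIntegral.integral_hasDerivAt_right (C0.intervalIntegrable _ 0 x)
    ((C0.continuous_coe _).stronglyMeasurableAtFilter _ _)
    (C0.continuous_coe _).continuousAt).congr_deriv ?_
  simp

theorem abs_mean_le (f : C0 N) : |mean N f| ≤ ‖f‖ := by
  have hN : (0 : ℝ) < N := Fact.out
  have := f.norm_integral_le 0 N
  rw [sub_zero, Nat.abs_cast, ← integral_apply, Real.norm_eq_abs, ← natCast_mul_mean, abs_mul,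
    Nat.abs_cast, mul_comm] at this
  exact le_of_mul_le_mul_right this hN

theorem norm_sub_mean_le (f : C0 N) : ‖f - mean N f • (1 : C0 N)‖ ≤ 2 * ‖f‖ := by
  refine (norm_sub_le _ _).trans ?_
  rw [norm_smul, norm_one, mul_one, Real.norm_eq_abs]
  linarith [abs_mean_le f]

theorem norm_primitive₀_le (f : C0 N) : ‖primitive₀ f‖ ≤ 2 * N * ‖f‖ := by
  refine (ContinuousMap.norm_le _ (by positivity)).mpr fun x => ?_
  obtain ⟨b, hb, rfl⟩ := AddCircle.eq_coe_Ico x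
  rw [primitive₀_coe]
  refine (C0.norm_integral_le _ 0 b).trans ?_
  calc _ ≤ (2 * ‖f‖) * N := by
        gcongr
        · exact norm_sub_mean_le f
        · rw [sub_zero, abs_of_nonneg hb.1]; exact hb.2.le
    _ = _ := by ring

variable (N) in
/-- The primitive of `f - mean f` that vanishes at `0`, as a bounded operator on `C⁰`. -/
def primitive₀L : C0 N →L[ℝ] C0 N :=
  LinearMap.mkContinuous
    { toFun := primitive₀
      map_add' := fun f g => C0.ext_coe fun x => by
        simp only [primitive₀_coe, ContinuousMap.add_apply]
        rw [← intervalIntegral.integral_add (C0.intervalIntegrable _ 0 x)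
          (C0.intervalIntegrable _ 0 x)]
        congr 1 with ξ
        simp
        ring
      map_smul' := fun a f => C0.ext_coe fun x => by
        simp only [primitive₀_coe, ContinuousMap.smul_apply, RingHom.id_apply]
        rw [← intervalIntegral.integral_smul]
        congr 1 with ξ
        simp
        ring }
    (2 * N) norm_primitive₀_le

variable (N) in
/-- The mean-zero primitive of `f - mean f`, as a bounded operator on `C⁰`. -/
def primitive : C0 N →L[ℝ] C0 N :=
  (ContinuousLinearMap.id ℝ _ - (mean N).smulRight (1 : C0 N)).comp (primitive₀L N)

theorem primitive_apply (f : C0 N) :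
    primitive N f = primitive₀ f - mean N (primitive₀ f) • (1 : C0 N) := rfl

theorem mean_primitive (f : C0 N) : mean N (primitive N f) = 0 := by
  rw [primitive_apply, map_sub, mean_const, sub_self]

theorem hasDerivAt_primitive (f : C0 N) (x : ℝ) :
    HasDerivAt (fun y : ℝ => primitive N f y) (f x - mean N f) x :=
  (hasDerivAt_primitive₀ f x).sub_const (mean N (primitive₀ f) * 1)

/-- A continuously differentiable periodic function is recovered from its derivative and mean. -/
theorem primitive_eq_of_hasDerivAt {f g : C0 N}
    (hfg : ∀ x : ℝ, HasDerivAt (fun y : ℝ => g y) (f x) x) (hf : mean N f = 0) :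
    primitive N f = g - mean N g • (1 : C0 N) := by
  have hconst : ∀ x : ℝ, primitive N f x - g x = primitive N f (0 : ℝ) - g (0 : ℝ) := fun x =>
    is_const_of_deriv_eq_zero (f := fun y : ℝ => primitive N f y - g y)
      (fun y => ((hasDerivAt_primitive f y).sub (hfg y)).differentiableAt)
      (fun y => ((hasDerivAt_primitive f y).sub (hfg y)).deriv.trans (by rw [hf]; ring)) x 0
  have heq : primitive N f = g + (primitive N f (0 : ℝ) - g (0 : ℝ)) • (1 : C0 N) :=
    C0.ext_coe fun x => by
      have := hconst x
      simp only [ContinuousMap.add_apply, ContinuousMap.smul_apply, ContinuousMap.one_apply,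
        smul_eq_mul, mul_one]
      linarith
  have hm := congrArg (mean N) heq
  rw [mean_primitive, map_add, mean_const] at hm
  rw [heq, show primitive N f (0 : ℝ) - g (0 : ℝ) = -mean N g by linarith, neg_smul, sub_eq_add_neg]

/-- The `C²` function `w` with `w'' + mean w = f`. -/
def solve (f : C0 N) : C2 N :=
  ⟨fun x => primitive N (primitive N f) x + mean N f, by
    have h1 : ∀ x : ℝ, HasDerivAt (fun y : ℝ => primitive N (primitive N f) y + mean N f)
        (primitive N f x) x := fun x => by
      simpa [mean_primitive] using (hasDerivAt_primitive (primitive N f) x).add_const (mean N f)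
    have h2 : ContDiff ℝ 1 (fun x : ℝ => primitive N f x) := by
      rw [contDiff_one_iff_deriv]
      refine ⟨fun x => (hasDerivAt_primitive f x).differentiableAt, ?_⟩
      rw [funext fun x => (hasDerivAt_primitive f x).deriv]
      exact f.continuous_coe.sub continuous_const
    refine ⟨?_, fun x => by simp only [C0.periodic_coe _ x]⟩
    rw [show (2 : WithTop ℕ∞) = 1 + 1 by norm_num, contDiff_succ_iff_deriv]
    refine ⟨fun x => (h1 x).differentiableAt, by simp, ?_⟩
    rwa [funext fun x => (h1 x).deriv]⟩

theorem d0_solve (f : C0 N) :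
    C2.d0 N (solve f) = primitive N (primitive N f) + mean N f • (1 : C0 N) :=
  C0.ext_coe fun x => by
    change primitive N (primitive N f) x + mean N f = primitive N (primitive N f) x + mean N f * 1
    rw [mul_one]

theorem d1_solve (f : C0 N) : C2.d1 N (solve f) = primitive N f :=
  C0.ext_coe fun x => by
    have h1 := (hasDerivAt_primitive (primitive N f) x).add_const (mean N f)
    rw [mean_primitive, sub_zero] at h1
    exact h1.deriv

theorem d2_solve (f : C0 N) : C2.d2 N (solve f) = f - mean N f • (1 : C0 N) :=
  C0.ext_coe fun x => by
    have h1 : deriv (solve f) = fun x : ℝ => primitive N f x :=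
      funext fun y => DFunLike.congr_fun (d1_solve f) (y : AddCircle (N : ℝ))
    rw [C2.d2_coe, h1, (hasDerivAt_primitive f x).deriv]
    simp

theorem C2.d0_injective : Function.Injective (C2.d0 N) := fun _ _ h =>
  C2.ext fun ξ => DFunLike.congr_fun h (ξ : AddCircle (N : ℝ))

variable (N) in
/-- The isomorphism `C⁰ ≃ C²` whose inverse is `w ↦ w'' + mean w`. -/
def solveEquiv : C0 N ≃L[ℝ] C2 N :=
  ContinuousLinearEquiv.equivOfInverse
    (LinearMap.mkContinuous
      { toFun := solve
        map_add' := fun f g => C2.d0_injective (by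
          simp only [map_add, d0_solve, add_smul]; abel)
        map_smul' := fun a f => C2.d0_injective (by
          simp only [map_smul, d0_solve, RingHom.id_apply, smul_add, smul_assoc]) }
      (‖primitive N‖ * ‖primitive N‖ + ‖primitive N‖ + 2) fun f => by
        have h1 := (primitive N).le_opNorm f
        have h2 := (primitive N).le_opNorm (primitive N f)
        have hp := norm_nonneg (primitive N)
        have hf := norm_nonneg f
        have h3 : ‖primitive N (primitive N f)‖ ≤ ‖primitive N‖ * (‖primitive N‖ * ‖f‖) :=
          h2.trans (by gcongr)
        have h4 : 0 ≤ ‖primitive N‖ * ‖f‖ := by positivity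
        have h5 : 0 ≤ ‖primitive N‖ * (‖primitive N‖ * ‖f‖) := by positivity
        refine C2.norm_le_of_jet ?_ ?_ ?_
        · refine (congrArg norm (d0_solve f)).le.trans ((norm_add_le _ _).trans ?_)
          rw [norm_smul, norm_one, mul_one, Real.norm_eq_abs]
          linarith [abs_mean_le f]
        · refine (congrArg norm (d1_solve f)).le.trans ?_
          linarith
        · refine (congrArg norm (d2_solve f)).le.trans ?_
          linarith [norm_sub_mean_le f])
    (C2.d2 N + ((mean N).comp (C2.d0 N)).smulRight (1 : C0 N))
    (fun f => by
      change C2.d2 N (solve f) + mean N (C2.d0 N (solve f)) • (1 : C0 N) = f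
      rw [d2_solve, d0_solve, map_add, mean_primitive, mean_const, zero_add, sub_add_cancel])
    (fun w => C2.d0_injective <| by
      change C2.d0 N (solve (C2.d2 N w + mean N (C2.d0 N w) • (1 : C0 N))) = C2.d0 N w
      have hm2 : mean N (C2.d2 N w) = 0 := by simp [mean, integral_deriv2_eq_zero]
      have hm1 : mean N (C2.d1 N w) = 0 := by simp [mean, integral_deriv_eq_zero]
      have hc : primitive N (1 : C0 N) = 0 := by
        have hp0 : primitive₀ (1 : C0 N) = 0 := C0.ext_coe fun x => by
          have := mean_const (N := N) 1
          rw [one_smul] at this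
          simp [primitive₀_coe, this]
        simp [primitive_apply, hp0]
      rw [d0_solve, map_add (mean N), mean_const, hm2, map_add, map_smul, hc, smul_zero, add_zero,
        primitive_eq_of_hasDerivAt (f := C2.d2 N w) (g := C2.d1 N w)
          (fun x => (w.differentiable_deriv x).hasDerivAt) hm2, hm1, zero_smul, sub_zero,
        primitive_eq_of_hasDerivAt (f := C2.d1 N w) (g := C2.d0 N w)
          (fun x => (w.differentiable x).hasDerivAt) hm1, zero_add, sub_add_cancel])

/-! ### Compactness -/

/-- A bounded operator on `C⁰(ℝ/Nℤ)` that maps the unit ball to uniformly Lipschitz functions is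
compact, by the Arzelà–Ascoli theorem. -/
theorem isCompactOperator_of_lipschitz (T : C0 N →L[ℝ] C0 N) (K : NNReal)
    (hT : ∀ f : C0 N, ‖f‖ ≤ 1 → LipschitzWith K (T f)) : IsCompactOperator T := by
  let e := ContinuousMap.isometryEquivBoundedOfCompact (AddCircle (N : ℝ)) ℝ
  let A : Set (C0 N) := T '' Metric.closedBall 0 1
  have hA : IsCompact (closure (e '' A)) := by
    refine BoundedContinuousFunction.arzela_ascoli (Metric.closedBall 0 ‖T‖)
      (isCompact_closedBall _ _) (e '' A) ?_ ?_
    · rintro _ x ⟨_, ⟨f, hf, rfl⟩, rfl⟩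
      rw [mem_closedBall_zero_iff] at hf ⊢
      exact ((T f).norm_coe_le_norm x).trans (T.le_of_opNorm_le_of_le le_rfl hf |>.trans_eq
        (mul_one _))
    · refine (LipschitzWith.uniformEquicontinuous _ K ?_).equicontinuous
      rintro ⟨_, _, ⟨f, hf, rfl⟩, rfl⟩
      exact hT f (mem_closedBall_zero_iff.mp hf)
  rw [isCompactOperator_iff_exists_mem_nhds_image_subset_compact]
  refine ⟨Metric.closedBall 0 1, Metric.closedBall_mem_nhds 0 one_pos,
    e.symm '' closure (e '' A), hA.image e.symm.continuous, ?_⟩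
  exact fun g hg => ⟨e g, subset_closure ⟨g, hg, rfl⟩, e.symm_apply_apply g⟩

theorem isCompactOperator_primitive : IsCompactOperator (primitive N) := by
  refine isCompactOperator_of_lipschitz _ 2 fun f hf => lipschitzWith_of_coe fun a b => ?_
  refine Convex.norm_image_sub_le_of_norm_hasDerivWithin_le (s := Set.univ)
    (f := fun x : ℝ => primitive N f x)
    (fun x _ => (hasDerivAt_primitive f x).hasDerivWithinAt) (fun x _ => ?_)
    convex_univ (Set.mem_univ b) (Set.mem_univ a)
  have h1 := (f - mean N f • (1 : C0 N)).norm_coe_le_norm (x : AddCircle (N : ℝ))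
  have h2 := norm_sub_mean_le f
  simp only [ContinuousMap.sub_apply, ContinuousMap.smul_apply, ContinuousMap.one_apply,
    smul_eq_mul, mul_one] at h1
  rw [NNReal.coe_ofNat]
  linarith

theorem isCompactOperator_functional {E : Type*} [NormedAddCommGroup E] [NormedSpace ℝ E]
    (φ : E →L[ℝ] ℝ) : IsCompactOperator φ :=
  (isCompactOperator_id (E := ℝ)).comp_clm φ

theorem isCompactOperator_smulRight {E F : Type*} [NormedAddCommGroup E] [NormedSpace ℝ E]
    [NormedAddCommGroup F] [NormedSpace ℝ F] (φ : E →L[ℝ] ℝ) (y : F) :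
    IsCompactOperator (φ.smulRight y) :=
  (isCompactOperator_functional φ).clm_comp ((ContinuousLinearMap.id ℝ ℝ).smulRight y)

theorem isCompactOperator_prodMk {E F G : Type*} [NormedAddCommGroup E] [NormedAddCommGroup F]
    [NormedAddCommGroup G] {f : E → F} {g : E → G} (hf : IsCompactOperator f)
    (hg : IsCompactOperator g) : IsCompactOperator fun x => (f x, g x) := by
  obtain ⟨K, hK, hfK⟩ := hf
  obtain ⟨K', hK', hgK'⟩ := hg
  exact ⟨K ×ˢ K', hK.prod hK', Filter.inter_mem hfK hgK'⟩

/-! ### The Fredholm alternative -/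

/-- An injective operator that is a compact perturbation of a nonzero multiple of the identity is
bijective. -/
theorem bijective_of_injective_of_isCompactOperator {X : Type*} [NormedAddCommGroup X]
    [NormedSpace ℝ X] [CompleteSpace X] {M : X →L[ℝ] X} {μ : ℝ} (hμ : μ ≠ 0)
    (hK : IsCompactOperator (M - μ • ContinuousLinearMap.id ℝ X))
    (hM : Function.Injective M) : Function.Bijective M := by
  rcases IsCompactOperator.hasEigenvalue_or_mem_resolventSet
    (T := M - μ • ContinuousLinearMap.id ℝ X) hK (neg_ne_zero.mpr hμ) with hev | hres
  · obtain ⟨x, hx⟩ := hev.exists_hasEigenvector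
    have h1 := hx.apply_eq_smul
    refine absurd (hM (a₁ := x) (a₂ := 0) ?_) hx.2
    simpa [sub_eq_iff_eq_add] using h1
  · rw [spectrum.mem_resolventSet_iff, ← IsUnit.neg_iff,
      ContinuousLinearMap.isUnit_iff_bijective] at hres
    convert hres using 2
    ext x
    simp [Algebra.algebraMap_eq_smul_one]

open ContinuousLinearMap in
/-- Composed with `C⁰ ≃ C²`, the derivative of the traveling-wave map is a compact perturbation of
`c² τ`. -/
theorem isCompactOperator_waveDeriv_solve (τ h v₀ : ℝ) (u : C2 N) (c : ℝ) :
    IsCompactOperator ((waveDeriv τ h v₀ u c).comp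
      ((solveEquiv N).prodCongr (ContinuousLinearEquiv.refl ℝ (ℝ × ℝ)) :
        C0 N × ℝ × ℝ →L[ℝ] C2 N × ℝ × ℝ)
      - (c ^ 2 * τ) • ContinuousLinearMap.id ℝ (C0 N × ℝ × ℝ)) := by
  set μ := c ^ 2 * τ
  let E : C0 N × ℝ × ℝ →L[ℝ] C2 N × ℝ × ℝ :=
    (solveEquiv N).prodCongr (ContinuousLinearEquiv.refl ℝ (ℝ × ℝ))
  let R := (waveDeriv τ h v₀ u c).comp E - μ • ContinuousLinearMap.id ℝ (C0 N × ℝ × ℝ)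
  have hP := isCompactOperator_primitive.comp_clm (fst ℝ (C0 N) (ℝ × ℝ))
  have h1 : IsCompactOperator fun q => (R q).1 := by
    have hsum := (((hP.clm_comp
      ((linVel h v₀ u).comp (primitive N) - c • ContinuousLinearMap.id ℝ _)).add
      (isCompactOperator_smulRight ((mean N).comp (fst ℝ (C0 N) (ℝ × ℝ)))
        (linVel h v₀ u 1 - μ • (1 : C0 N)))).add
      (isCompactOperator_smulRight ((fst ℝ ℝ ℝ).comp (snd ℝ (C0 N) (ℝ × ℝ))) (waveDc τ u c))).add
      (isCompactOperator_smulRight ((snd ℝ ℝ ℝ).comp (snd ℝ (C0 N) (ℝ × ℝ))) (1 : C0 N))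
    refine (congrArg (fun f : C0 N × ℝ × ℝ → C0 N => IsCompactOperator f)
      (funext fun q => ?_)).mpr hsum
    change waveDeriv₁ τ h v₀ u c (solve q.1, q.2) - μ • q.1
      = linVel h v₀ u (primitive N (primitive N q.1)) - c • primitive N q.1
        + mean N q.1 • (linVel h v₀ u 1 - μ • (1 : C0 N)) + q.2.1 • waveDc τ u c
        + q.2.2 • (1 : C0 N)
    simp only [waveDeriv₁_apply, linWave_apply, d0_solve, d1_solve, d2_solve, map_add, map_smul]
    module
  exact isCompactOperator_prodMk h1 (isCompactOperator_prodMk (isCompactOperator_functional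
    ((fst ℝ ℝ ℝ).comp ((snd ℝ (C0 N) (ℝ × ℝ)).comp R)))
    (isCompactOperator_functional ((snd ℝ ℝ ℝ).comp ((snd ℝ (C0 N) (ℝ × ℝ)).comp R))))

/-! ### The wave speed does not vanish -/

/-- At wave speed zero the linearization is `w ↦ V'(u) w - (V'(u) w)(· + 1)`, which vanishes when
`V'(u) w` is 1-periodic. -/
theorem linWave_zero_weighted (τ h v₀ : ℝ) (u : C2 N) (g : ℝ → ℝ) (hg : ContDiff ℝ 2 g)
    (hp : Function.Periodic g 1) : linWave τ h v₀ u 0 (weighted h u g hg hp) = 0 := by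
  have key : ∀ y : ℝ, optVelDeriv h v₀ (u y) * weighted h u g hg hp y = v₀ * g y := fun y => by
    have := (Real.cosh_pos (u y - h)).ne'
    rw [optVelDeriv, weighted_coe]
    field_simp
  have hlin : linVel h v₀ u (C2.d0 N (weighted h u g hg hp)) = 0 := C0.ext_coe fun x => by
    change -(optVelDeriv h v₀ (u (x + 1)) * weighted h u g hg hp (x + 1))
      + optVelDeriv h v₀ (u x) * weighted h u g hg hp x = 0
    rw [key, key, hp x, neg_add_cancel]
  rw [linWave_apply, hlin]
  simp

theorem speed_ne_zero {τ h v₀ c : ℝ} {u : C2 N}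
    (hdim : Module.finrank ℝ (LinearMap.ker (linWave τ h v₀ u c).toLinearMap) = 2) : c ≠ 0 := by
  rintro rfl
  have hcos : Function.Periodic (fun x : ℝ => Real.cos (2 * Real.pi * x)) 1 := fun x => by
    simp only [mul_add, mul_one, Real.cos_add_two_pi]
  have hsin : Function.Periodic (fun x : ℝ => Real.sin (2 * Real.pi * x)) 1 := fun x => by
    simp only [mul_add, mul_one, Real.sin_add_two_pi]
  let w0 := weighted h u (fun _ => 1) contDiff_const (fun _ => rfl)
  let w1 := weighted h u _ (Real.contDiff_cos.comp (contDiff_const.mul contDiff_id)) hcos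
  let w2 := weighted h u _ (Real.contDiff_sin.comp (contDiff_const.mul contDiff_id)) hsin
  let b : Fin 3 → LinearMap.ker (linWave τ h v₀ u 0).toLinearMap :=
    ![⟨w0, linWave_zero_weighted τ h v₀ u _ _ _⟩, ⟨w1, linWave_zero_weighted τ h v₀ u _ _ _⟩,
      ⟨w2, linWave_zero_weighted τ h v₀ u _ _ _⟩]
  have hb : LinearIndependent ℝ b := by
    rw [Fintype.linearIndependent_iff]
    intro a ha
    have heq : a 0 • w0 + a 1 • w1 + a 2 • w2 = 0 := by
      simpa [Fin.sum_univ_three, b] using congrArg Subtype.val ha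
    have hval : ∀ x : ℝ, a 0 + a 1 * Real.cos (2 * Real.pi * x)
        + a 2 * Real.sin (2 * Real.pi * x) = 0 := fun x => by
      have h1 : a 0 * (1 * Real.cosh (u x - h) ^ 2)
          + a 1 * (Real.cos (2 * Real.pi * x) * Real.cosh (u x - h) ^ 2)
          + a 2 * (Real.sin (2 * Real.pi * x) * Real.cosh (u x - h) ^ 2) = 0 :=
        congrArg (fun w : C2 N => w x) heq
      refine (mul_eq_zero.mp ?_).resolve_right (pow_ne_zero 2 (Real.cosh_pos (u x - h)).ne')
      linear_combination h1
    have e0 := hval 0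
    have e1 := hval (1 / 2)
    have e2 := hval (1 / 4)
    rw [mul_zero, Real.cos_zero, Real.sin_zero] at e0
    rw [show 2 * Real.pi * (1 / 2) = Real.pi by ring, Real.cos_pi, Real.sin_pi] at e1
    rw [show 2 * Real.pi * (1 / 4) = Real.pi / 2 by ring, Real.cos_pi_div_two,
      Real.sin_pi_div_two] at e2
    intro i
    fin_cases i
    · change a 0 = 0; linarith
    · change a 1 = 0; linarith
    · change a 2 = 0; linarith
  have hfin : FiniteDimensional ℝ (LinearMap.ker (linWave τ h v₀ u 0).toLinearMap) :=
    FiniteDimensional.of_finrank_pos (by omega)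
  have := hb.fintype_card_le_finrank
  rw [hdim, Fintype.card_fin] at this
  omega

/-! ### Injectivity of the linearization -/

/-- A periodic solution of `a f' = c f` with `a, c ≠ 0` vanishes. -/
theorem eq_zero_of_periodic_of_ode {f f' : ℝ → ℝ} {p a c : ℝ} (hp : p ≠ 0) (ha : a ≠ 0)
    (hc : c ≠ 0) (hper : Function.Periodic f p) (hf : ∀ x, HasDerivAt f (f' x) x)
    (hode : ∀ x, a * f' x = c * f x) (x : ℝ) : f x = 0 := by
  let g : ℝ → ℝ := fun y => f y * Real.exp (-(c / a) * y)
  have hg : ∀ y, HasDerivAt g 0 y := fun y => by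
    refine ((hf y).mul ((hasDerivAt_id y).const_mul (-(c / a))).exp).congr_deriv ?_
    have h1 : f' y = c / a * f y := by
      field_simp
      linear_combination hode y
    simp only [id, h1]
    ring
  have hconst : g (x + p) = g x :=
    is_const_of_deriv_eq_zero (fun y => (hg y).differentiableAt) (fun y => (hg y).deriv) _ _
  simp only [g, hper x, mul_add, Real.exp_add] at hconst
  have hne : Real.exp (-(c / a) * p) ≠ 1 := by
    rw [Ne, Real.exp_eq_one_iff]
    exact mul_ne_zero (neg_ne_zero.mpr (div_ne_zero hc ha)) hp
  have h2 : f x * Real.exp (-(c / a) * x) * (Real.exp (-(c / a) * p) - 1) = 0 := by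
    linear_combination hconst
  rcases mul_eq_zero.mp h2 with h3 | h3
  · exact (mul_eq_zero.mp h3).resolve_right (Real.exp_pos _).ne'
  · exact absurd (sub_eq_zero.mp h3) hne

/-- For a traveling wave the velocities at the integer translates of a point add up to zero: summing
the wave equation over the translates, the terms with `V` telescope, and what is left is the linear
equation `c² τ G' = c G` for the periodic function `G = ∑ u'(· + n)`. -/
theorem sumNat_deriv_eq_zero {τ h v₀ c : ℝ} {u : C2 N} (hτ : τ ≠ 0) (hc : c ≠ 0)
    (hu : waveMap₁ τ h v₀ u c 0 = 0) : sumNat N (C2.d1 N u) = 0 := by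
  have hwave : ∀ ξ : ℝ, c ^ 2 * τ * deriv (deriv u) ξ - c * deriv u ξ
      - optVel h v₀ (u (ξ + 1)) + optVel h v₀ (u ξ) + 0 = 0 := fun ξ =>
    DFunLike.congr_fun hu (ξ : AddCircle (N : ℝ))
  let G : ℝ → ℝ := fun x => ∑ n ∈ Finset.range N, deriv u (x + n)
  have hG : ∀ x, HasDerivAt G (∑ n ∈ Finset.range N, deriv (deriv u) (x + n)) x := fun x =>
    HasDerivAt.fun_sum fun n _ => (u.differentiable_deriv (x + n)).hasDerivAt.comp_add_const x n
  have hper : Function.Periodic G N := fun x =>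
    Finset.sum_congr rfl fun n _ => by rw [add_right_comm, periodic_deriv u.periodic]
  have hode : ∀ x, c ^ 2 * τ * (∑ n ∈ Finset.range N, deriv (deriv u) (x + n)) = c * G x :=
    fun x => by
      have htel := Finset.sum_range_sub (fun n : ℕ => optVel h v₀ (u (x + n))) N
      rw [Nat.cast_zero, add_zero, u.periodic x, sub_self] at htel
      simp only [G, Finset.mul_sum]
      rw [← sub_eq_zero, ← Finset.sum_sub_distrib, ← htel]
      refine Finset.sum_congr rfl fun n _ => ?_
      have := hwave (x + n)
      rw [add_assoc x] at this
      push_cast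
      linear_combination this
  have h0 := eq_zero_of_periodic_of_ode (NeZero.ne (N : ℝ)) (mul_ne_zero (pow_ne_zero 2 hc) hτ) hc
    hper hG hode 0
  simpa [sumNat_apply, G] using h0

/-- A profile whose derivative has zero square integral over a period has zero derivative. -/
theorem deriv_eq_zero_of_integral_sq {u : C2 N}
    (hu : integral N (C2.d1 N u * C2.d1 N u) = 0) : deriv u = 0 := by
  by_contra hne
  obtain ⟨x, hx⟩ := Function.ne_iff.mp hne
  have hN : (0 : ℝ) < N := Fact.out
  obtain ⟨y, hy, hxy⟩ := (periodic_deriv u.periodic).exists_mem_Ico₀ hN x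
  have hpos : 0 < ∫ ξ in (0 : ℝ)..(N : ℝ), deriv u ξ * deriv u ξ :=
    intervalIntegral.integral_pos hN (u.continuous_deriv.mul u.continuous_deriv).continuousOn
      (fun ξ _ => mul_self_nonneg _) ⟨y, Set.Ico_subset_Icc_self hy, by
        rw [← hxy]; exact mul_self_pos.mpr hx⟩
  exact hpos.ne' hu

/-- At a traveling wave that meets the nondegeneracy conditions the linearization is injective. -/
theorem injective_waveDeriv {τ h v₀ c : ℝ} {u v : C2 N} (hτ : τ ≠ 0)
    (hu : waveMap₁ τ h v₀ u c 0 = 0)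
    (hdim : Module.finrank ℝ (LinearMap.ker (linWave τ h v₀ u c).toLinearMap) = 2)
    (hspan : (LinearMap.ker (linWave τ h v₀ u c).toLinearMap).map (C2.coeLinear N)
      = Submodule.span ℝ {deriv u, (v : ℝ → ℝ)})
    (hv : ∑ n ∈ Finset.range N, v (n : ℝ) ≠ 0)
    (hDc : waveDc τ u c ∉ Set.range (linWave τ h v₀ u c)) :
    Function.Injective (waveDeriv τ h v₀ u c) := by
  refine (injective_iff_map_eq_zero _).mpr fun ⟨w, s, d⟩ hq => ?_
  rw [waveDeriv_apply, waveDeriv₁_apply] at hq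
  have hq1 : linWave τ h v₀ u c w + s • waveDc τ u c + d • (1 : C0 N) = 0 := congrArg Prod.fst hq
  have hq2 : sumNat N (C2.d0 N w) = 0 := neg_eq_zero.mp (congrArg (fun q => q.2.1) hq)
  have hq3 : integral N (C2.d1 N u * C2.d0 N w) = 0 :=
    neg_eq_zero.mp (congrArg (fun q => q.2.2) hq)
  -- Integrating the first component over a period removes everything but `d`.
  have hd : d = 0 := by
    have h1 := congrArg (integral N) hq1
    simp only [map_add, map_smul, integral_linWave, integral_waveDc, integral_one, map_zero,
      smul_eq_mul, mul_zero, zero_add] at h1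
    exact (mul_eq_zero.mp h1).resolve_right (NeZero.ne (N : ℝ))
  subst hd
  rw [zero_smul, add_zero] at hq1
  have hs : s = 0 := by
    by_contra hs
    refine hDc ⟨-s⁻¹ • w, ?_⟩
    rw [map_smul, eq_neg_of_add_eq_zero_left hq1, smul_neg, neg_smul, neg_neg, inv_smul_smul₀ hs]
  subst hs
  rw [zero_smul, add_zero] at hq1
  have hw : C2.coeLinear N w ∈ Submodule.span ℝ {deriv u, (v : ℝ → ℝ)} :=
    hspan ▸ Submodule.mem_map_of_mem hq1
  obtain ⟨a, b, hab⟩ := Submodule.mem_span_pair.mp hw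
  have hwx : C2.d0 N w = a • C2.d1 N u + b • C2.d0 N v := C0.ext_coe fun x => (congrFun hab x).symm
  have hb : b = 0 := by
    rw [hwx, map_add, map_smul, map_smul, sumNat_deriv_eq_zero hτ (speed_ne_zero hdim) hu,
      smul_zero, zero_add, smul_eq_mul, sumNat_apply] at hq2
    exact (mul_eq_zero.mp hq2).resolve_right hv
  rw [hb, zero_smul, add_zero] at hwx
  have ha : a = 0 := by
    rw [hwx, mul_smul_comm, map_smul] at hq3
    exact (smul_eq_zero.mp hq3).resolve_right fun h0 =>
      ne_zero_of_finrank_eq_two hdim hspan (deriv_eq_zero_of_integral_sq h0)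
  rw [ha, zero_smul, ← map_zero (C2.d0 N)] at hwx
  rw [C2.d0_injective hwx]
  rfl

end

end TrafficWave

open TrafficWave in
theorem theorem1 (N : ℕ) [NeZero N] (τ h v₀ L : ℝ) (hτ : 0 < τ)
    (uStar v : TrafficWave.C2 N) (cStar : ℝ)
    (hzero : TrafficWave.waveMap τ h v₀ L uStar (uStar, cStar, 0) = 0)
    (hdim : Module.finrank ℝ (LinearMap.ker (TrafficWave.Du τ h v₀ uStar cStar 0).toLinearMap) = 2)
    (hspan : (fun w : TrafficWave.C2 N => (w : ℝ → ℝ)) ''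
        {w | TrafficWave.Du τ h v₀ uStar cStar 0 w = 0} =
      (Submodule.span ℝ {deriv uStar, (v : ℝ → ℝ)} : Set (ℝ → ℝ)))
    (hv : ∑ n ∈ Finset.range N, v (n : ℝ) ≠ 0)
    (hc : TrafficWave.Dc τ h v₀ uStar cStar 0 ∉
      Set.range (TrafficWave.Du τ h v₀ uStar cStar 0)) :
    ∃ T : (TrafficWave.C2 N × ℝ × ℝ) ≃L[ℝ] (TrafficWave.C0 N × ℝ × ℝ),
      HasFDerivAt (TrafficWave.waveMap τ h v₀ L uStar)
        (T : TrafficWave.C2 N × ℝ × ℝ →L[ℝ] TrafficWave.C0 N × ℝ × ℝ)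
        (uStar, cStar, 0) := by
  rw [Du_eq] at hdim hc hspan
  rw [Dc_eq] at hc
  have hspan' : (LinearMap.ker (linWave τ h v₀ uStar cStar).toLinearMap).map (C2.coeLinear N)
      = Submodule.span ℝ {deriv uStar, (v : ℝ → ℝ)} := SetLike.coe_injective hspan
  have hinj := injective_waveDeriv hτ.ne' (congrArg Prod.fst hzero) hdim hspan' hv hc
  let E := (solveEquiv N).prodCongr (ContinuousLinearEquiv.refl ℝ (ℝ × ℝ))
  let M := (waveDeriv τ h v₀ uStar cStar).comp (E : C0 N × ℝ × ℝ →L[ℝ] C2 N × ℝ × ℝ)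
  have hM : Function.Bijective M := bijective_of_injective_of_isCompactOperator
    (mul_ne_zero (pow_ne_zero 2 (speed_ne_zero hdim)) hτ.ne')
    (isCompactOperator_waveDeriv_solve τ h v₀ uStar cStar) (hinj.comp E.injective)
  let M' := ContinuousLinearEquiv.ofBijective M (LinearMap.ker_eq_bot.mpr hM.1)
    (LinearMap.range_eq_top.mpr hM.2)
  refine ⟨E.symm.trans M', ?_⟩
  convert hasFDerivAt_waveMap τ h v₀ L uStar cStar 0 using 1
  refine ContinuousLinearMap.ext fun q => ?_
  change waveDeriv τ h v₀ uStar cStar (E (E.symm q)) = _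
  rw [E.apply_symm_apply]
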